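/- Let $k$ be a quadratic number field whose discriminant factors as $d = d_1d_2d_3$, where each $d_i$ is a prime discriminant, i.e. $d_i \in \{-4, 8, -8\}$ or $d_i = \pm p$ for an odd prime $p$, with the sign chosen so that $d_i \equiv 1 \pmod 4$. Call a finite Galois extension $M/k$ an unramified $H_8$-extension if $\operatorname{Gal}(M/k)$ is isomorphic to the quaternion group $H_8$ of order $8$ and no finite prime ramifies in $M/k$ (ramification at the infinite places is allowed). Then $k$ has at most one unramified $H_8$-extension: if $M$ and $N$ are unramified $H_8$-extensions of $k$ contained in a common extension field $\Omega$ of $k$ (for example, a fixed algebraic closure of $k$), then $M = N$. -/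

import Mathlib

open scoped NumberField

/-- A prime discriminant: the discriminant of a quadratic number field in which exactly one
rational prime ramifies, that is `-4`, `8`, `-8`, or `±p` with `p` an odd prime and the sign
chosen such that `±p ≡ 1 (mod 4)`. -/
def IsPrimeDiscriminant (d : ℤ) : Prop :=
  d = -4 ∨ d = 8 ∨ d = -8 ∨ (d.natAbs.Prime ∧ d ≡ 1 [ZMOD 4])

/-- `M/k` is unramified at all finite primes (no condition at the infinite places). -/
def IsUnramifiedOutsideInfinity (k M : Type*) [Field k] [Field M] [Algebra k M] : Prop :=
  ∀ (P : Ideal (𝓞 M)) (_ : P.IsMaximal), Algebra.IsUnramifiedAt (𝓞 k) P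

/-- `M/k` is an unramified `H₈`-extension: a finite Galois extension, unramified at all finite
primes, whose Galois group is isomorphic to the quaternion group of order `8`
(`QuaternionGroup n` has order `4 * n`). It is not required to be normal over `ℚ`. -/
structure IsUnramifiedH8Extension (k M : Type*) [Field k] [Field M] [Algebra k M] : Prop where
  finiteDimensional : FiniteDimensional k M
  isGalois : IsGalois k M
  galois_group : Nonempty (Gal(M/k) ≃* QuaternionGroup 2)
  unramified : IsUnramifiedOutsideInfinity k M

/-! Let `F` be the Galois closure over `ℚ` of the compositum of `M` and `N`. The inertia groups of
the finite primes generate `Gal(F/ℚ)`, because `ℚ` has no nontrivial extension unramified at all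
finite primes. As `M` and `N` are unramified over `k`, each inertia group meets `Gal(F/k)` inside
the intersection `D` of the subgroups fixing `M` and `N`, and even inside the normal core `C` of `D`
in `Gal(F/ℚ)`. Modulo `C` the group `Gal(F/ℚ)` is thus a `2`-group which is the normal closure of
one involution `t₀, t₁, t₂` for each prime ramified in `k`. Since a nilpotent group is generated by
any set of normal generators, the `tᵢ` generate it, so that `Gal(F/k)`, consisting of the words of
even length, is generated by `t₀t₁` and `t₀t₂` modulo `C`. The restrictions of these two elements
generate both `Gal(M/k)` and `Gal(N/k)`. Since any two generating pairs of `H₈` differ by an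
automorphism, the restriction maps onto these groups have the same kernel.
-/

open scoped Pointwise
open Subgroup (closure normalClosure)

theorem closure_eq_top_of_normalClosure_eq_top {G : Type*} [Group G]
    [IsCoatomic (Subgroup G)] [Group.IsNilpotent G] {S : Set G} (hS : normalClosure S = ⊤) :
    closure S = ⊤ := by
  by_contra hne
  obtain ⟨K, hK, hSK⟩ := (eq_top_or_exists_le_coatom (closure S)).resolve_left hne
  have : K.Normal :=
    Subgroup.NormalizerCondition.normal_of_coatom K Group.normalizerCondition_of_isNilpotent hK
  have hle : normalClosure S ≤ K :=
    Subgroup.normalClosure_le_normal ((Subgroup.closure_le K).mp hSK)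
  exact hK.1 (top_le_iff.mp (hS.ge.trans hle))

theorem mem_or_mul_mem_closure_of_involutions {ι G : Type*} [Group G] {s₀ : G} {s : ι → G}
    (h₀ : s₀ * s₀ = 1) (hs : ∀ i, s i * s i = 1)
    (hgen : closure (insert s₀ (Set.range s)) = ⊤) (g : G) :
    g ∈ closure (Set.range fun i ↦ s₀ * s i) ∨
      s₀ * g ∈ closure (Set.range fun i ↦ s₀ * s i) := by
  set B := closure (Set.range fun i ↦ s₀ * s i)
  have hmem (i : ι) : s₀ * s i ∈ B := Subgroup.subset_closure ⟨i, rfl⟩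
  have hinvol : ∀ t ∈ insert s₀ (Set.range s), t⁻¹ = t := by
    rintro t (rfl | ⟨i, rfl⟩)
    exacts [inv_eq_of_mul_eq_one_left h₀, inv_eq_of_mul_eq_one_left (hs i)]
  have hstep : ∀ t ∈ insert s₀ (Set.range s), ∀ g, g ∈ B ∨ s₀ * g ∈ B →
      t * g ∈ B ∨ s₀ * (t * g) ∈ B := by
    rintro t (rfl | ⟨i, rfl⟩) g (hg | hg)
    · exact .inr (by rwa [← mul_assoc, h₀, one_mul])
    · exact .inl hg
    · exact .inr (by simpa only [mul_assoc] using B.mul_mem (hmem i) hg)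
    · refine .inl ?_
      have heq : s i * g = (s₀ * s i)⁻¹ * (s₀ * g) := by
        rw [mul_inv_rev, hinvol _ (.inr ⟨i, rfl⟩), mul_assoc, inv_mul_cancel_left]
      exact heq ▸ B.mul_mem (B.inv_mem (hmem i)) hg
  have hg : g ∈ closure (insert s₀ (Set.range s)) := hgen ▸ Subgroup.mem_top g
  induction hg using Subgroup.closure_induction_left with
  | one => exact .inl B.one_mem
  | mul_left t ht g _ ih => exact hstep t ht g ih
  | inv_mul_cancel t ht g _ ih => exact (hinvol t ht).symm ▸ hstep t ht g ih

theorem le_closure_sup_of_index_eq_two {G : Type*} [Group G] {n : ℕ} {A C : Subgroup G}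
    [C.Normal] [Finite (G ⧸ C)] [Group.IsNilpotent (G ⧸ C)] (hA : A.index = 2) (hCA : C ≤ A)
    {t : Fin (n + 1) → G} (htA : ∀ j, t j ∉ A) (htC : ∀ j, t j * t j ∈ C)
    (hgen : normalClosure (Set.range t) ⊔ C = ⊤) :
    A ≤ closure (Set.range fun i : Fin n ↦ t 0 * t i.succ) ⊔ C := by
  let π := QuotientGroup.mk' C
  have hπ : Function.Surjective π := QuotientGroup.mk'_surjective C
  have hinvol (j) : π (t j) * π (t j) = 1 := by
    rw [← map_mul]
    exact (QuotientGroup.eq_one_iff _).mpr (htC j)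
  have hclosure : closure (insert (π (t 0)) (Set.range fun i : Fin n ↦ π (t i.succ))) = ⊤ := by
    have hnormal : normalClosure (Set.range (π ∘ t)) = ⊤ := by
      rw [Set.range_comp, ← Subgroup.map_normalClosure _ _ hπ, ← sup_bot_eq (Subgroup.map _ _),
        ← (Subgroup.map_eq_bot_iff C (f := π)).mpr (QuotientGroup.ker_mk' C).ge,
        ← Subgroup.map_sup, hgen, Subgroup.map_top_of_surjective π hπ]
    have := closure_eq_top_of_normalClosure_eq_top hnormal
    rwa [Fin.range_fin_succ] at this
  set B := closure (Set.range fun i : Fin n ↦ t 0 * t i.succ)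
  have hBA : B ⊔ C ≤ A := sup_le ((Subgroup.closure_le A).mpr <| Set.range_subset_iff.mpr fun i ↦
    (Subgroup.mul_mem_iff_of_index_two hA).mpr (iff_of_false (htA 0) (htA _))) hCA
  have hpull (g : G) (hg : π g ∈ closure (Set.range fun i : Fin n ↦ π (t 0) * π (t i.succ))) :
      g ∈ B ⊔ C := by
    have hmap : closure (Set.range fun i : Fin n ↦ π (t 0) * π (t i.succ)) = B.map π := by
      rw [MonoidHom.map_closure, ← Set.range_comp]
      rfl
    rw [← QuotientGroup.ker_mk' C, ← Subgroup.comap_map_eq]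
    exact hmap ▸ hg
  intro a ha
  rcases mem_or_mul_mem_closure_of_involutions (hinvol 0) (fun i : Fin n ↦ hinvol i.succ)
    hclosure (π a) with h | h
  · exact hpull a h
  · have hmem : t 0 * a ∈ A := hBA (hpull (t 0 * a) (map_mul π _ _ ▸ h))
    exact absurd ((Subgroup.mul_mem_cancel_right A ha).mp hmem) (htA 0)

theorem isPGroup_quotient_normalCore {G : Type*} [Group G] {p m : ℕ} {A N : Subgroup G}
    [hAn : A.Normal] (hA : IsPGroup p (G ⧸ A)) (hN : ∀ a ∈ A, a ^ p ^ m ∈ N) :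
    IsPGroup p (G ⧸ N.normalCore) := by
  intro q
  obtain ⟨g, rfl⟩ := QuotientGroup.mk_surjective q
  obtain ⟨l, hl⟩ := hA g
  rw [← QuotientGroup.mk_pow, QuotientGroup.eq_one_iff] at hl
  refine ⟨l + m, ?_⟩
  rw [← QuotientGroup.mk_pow, QuotientGroup.eq_one_iff, pow_add, pow_mul]
  intro b
  rw [← conj_pow]
  exact hN _ (hAn.conj_mem _ hl b)

theorem inf_le_normalCore_of_forall_conj_smul_mem {G : Type*} [Group G] {A N : Subgroup G}
    [hA : A.Normal] {𝓘 : Set (Subgroup G)} (hconj : ∀ I ∈ 𝓘, ∀ g : G, MulAut.conj g • I ∈ 𝓘)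
    (hN : ∀ I ∈ 𝓘, I ⊓ A ≤ N) {I : Subgroup G} (hI : I ∈ 𝓘) : I ⊓ A ≤ N.normalCore :=
  fun τ hτ g ↦ hN _ (hconj I hI g)
    ⟨Subgroup.smul_mem_pointwise_smul τ (MulAut.conj g) I hτ.1, hA.conj_mem τ hτ.2 g⟩

theorem exists_representatives_normalClosure_sup_eq_top {κ G : Type*} [Group G]
    {A C : Subgroup G} [hC : C.Normal] (hA : A.index = 2)
    {𝓘 : Set (Subgroup G)} (htop : sSup 𝓘 = ⊤) (hIC : ∀ I ∈ 𝓘, I ⊓ A ≤ C)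
    {J : κ → Subgroup G} (hJ : ∀ j, J j ∈ 𝓘)
    (hcover : ∀ I ∈ 𝓘, I ≤ A ∨ ∃ j, ∃ g : G, MulAut.conj g • J j = I) :
    ∃ t : κ → G, (∀ j, t j ∉ A) ∧ (∀ j, t j * t j ∈ C) ∧ normalClosure (Set.range t) ⊔ C = ⊤ := by
  obtain ⟨I₀, hI₀, hI₀A⟩ : ∃ I ∈ 𝓘, ¬ I ≤ A := by
    by_contra! hle
    have hA_top : A = ⊤ := top_le_iff.mp (htop ▸ sSup_le hle)
    simp [hA_top] at hA
  -- If `J j ≤ A`, then `J j ≤ C`, and any element of `I₀` outside `A` can serve as `t j`.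
  have hchoice (j) : ∃ I ∈ 𝓘, ∃ t ∈ I, t ∉ A ∧ (J j ≤ A ∨ I = J j) := by
    by_cases hj : J j ≤ A
    · obtain ⟨t, htI, htA⟩ := SetLike.not_le_iff_exists.mp hI₀A
      exact ⟨I₀, hI₀, t, htI, htA, .inl hj⟩
    · obtain ⟨t, htJ, htA⟩ := SetLike.not_le_iff_exists.mp hj
      exact ⟨J j, hJ j, t, htJ, htA, .inr rfl⟩
  choose I hI t htI htA hIJ using hchoice
  refine ⟨t, htA, fun j ↦ hIC _ (hI j)
    ⟨mul_mem (htI j) (htI j), Subgroup.mul_self_mem_of_index_two hA _⟩, ?_⟩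
  have hJ_le (j) : J j ≤ normalClosure (Set.range t) ⊔ C := by
    intro τ hτ
    by_cases hτA : τ ∈ A
    · exact Subgroup.mem_sup_right (hIC _ (hJ j) ⟨hτ, hτA⟩)
    obtain hle | heq := hIJ j
    · exact absurd (hle hτ) hτA
    have hquot : τ * (t j)⁻¹ ∈ C := hIC _ (hJ j) ⟨(J j).mul_mem hτ ((J j).inv_mem (heq ▸ htI j)),
      (Subgroup.mul_mem_iff_of_index_two hA).mpr (iff_of_false hτA (A.inv_mem_iff.not.mpr (htA j)))⟩
    rw [← inv_mul_cancel_right τ (t j)]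
    exact mul_mem (Subgroup.mem_sup_right hquot)
      (Subgroup.mem_sup_left (Subgroup.subset_normalClosure ⟨j, rfl⟩))
  refine top_le_iff.mp (htop ▸ sSup_le fun I hI ↦ ?_)
  obtain hle | ⟨j, g, rfl⟩ := hcover I hI
  · exact (le_inf le_rfl hle).trans ((hIC I hI).trans le_sup_right)
  · exact (Subgroup.pointwise_smul_le_pointwise_smul_iff.mpr (hJ_le j)).trans_eq
      (Subgroup.Normal.conj_smul_eq_self g _)

/-- The automorphisms of `H` act transitively on the generating `n`-tuples of `H`. For `n = 2` this
is the property of the quaternion group of order `8` that forces two unramified extensions with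
that Galois group to coincide. -/
def MulAutTransitiveOnGenerators (n : ℕ) (H : Type*) [Group H] : Prop :=
  ∀ x y : Fin n → H, closure (Set.range x) = ⊤ → closure (Set.range y) = ⊤ →
    ∃ θ : H ≃* H, ∀ i, θ (x i) = y i

theorem ker_eq_ker_of_closure_sup_eq_top {n : ℕ} {A H : Type*} [Group A] [Group H]
    (hH : MulAutTransitiveOnGenerators n H) {φ ψ : A →* H} (hφ : Function.Surjective φ)
    (hψ : Function.Surjective ψ) {x : Fin n → A}
    (hx : closure (Set.range x) ⊔ (φ.ker ⊓ ψ.ker) = ⊤) : φ.ker = ψ.ker := by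
  have hgen {χ : A →* H} (hχ : Function.Surjective χ) (hle : φ.ker ⊓ ψ.ker ≤ χ.ker) :
      closure (Set.range (χ ∘ x)) = ⊤ := by
    rw [Set.range_comp, ← MonoidHom.map_closure, ← sup_bot_eq (Subgroup.map _ _),
      ← (Subgroup.map_eq_bot_iff _).mpr hle, ← Subgroup.map_sup, hx,
      Subgroup.map_top_of_surjective χ hχ]
  obtain ⟨θ, hθ⟩ := hH _ _ (hgen hφ inf_le_left) (hgen hψ inf_le_right)
  have hker : φ.ker ⊓ ψ.ker ≤ (θ.toMonoidHom.comp φ).eqLocus ψ := fun a ha ↦ by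
    change θ (φ a) = ψ a
    rw [MonoidHom.mem_ker.mp ha.1, MonoidHom.mem_ker.mp ha.2, map_one]
  have heq : ⊤ ≤ (θ.toMonoidHom.comp φ).eqLocus ψ :=
    hx ▸ sup_le ((Subgroup.closure_le _).mpr (Set.range_subset_iff.mpr hθ)) hker
  ext a
  have ha : θ (φ a) = ψ a := heq (Subgroup.mem_top a)
  rw [MonoidHom.mem_ker, MonoidHom.mem_ker, ← ha]
  exact (map_eq_one_iff θ θ.injective).symm

theorem ker_eq_ker_of_index_eq_two {n : ℕ} {G A H : Type*} [Group G] [Finite G] [Group A]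
    [Group H] (hH : IsPGroup 2 H) (hgen : MulAutTransitiveOnGenerators n H)
    {ι : A →* G} (hι : Function.Injective ι) (hA : ι.range.index = 2)
    {φ ψ : A →* H} (hφ : Function.Surjective φ) (hψ : Function.Surjective ψ)
    {𝓘 : Set (Subgroup G)} (hconj : ∀ I ∈ 𝓘, ∀ g : G, MulAut.conj g • I ∈ 𝓘)
    (htop : sSup 𝓘 = ⊤) (hker : ∀ I ∈ 𝓘, I.comap ι ≤ φ.ker ⊓ ψ.ker)
    {J : Fin (n + 1) → Subgroup G} (hJ : ∀ j, J j ∈ 𝓘)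
    (hcover : ∀ I ∈ 𝓘, I ≤ ι.range ∨ ∃ j, ∃ g : G, MulAut.conj g • J j = I) :
    φ.ker = ψ.ker := by
  have : Fact (Nat.Prime 2) := ⟨Nat.prime_two⟩
  have : Finite A := Finite.of_injective ι hι
  have : Finite H := Finite.of_surjective φ hφ
  have : ι.range.Normal := Subgroup.normal_of_index_eq_two hA
  let N : Subgroup G := (φ.ker ⊓ ψ.ker).map ι
  have hN : ∀ I ∈ 𝓘, I ⊓ ι.range ≤ N := fun I hI ↦
    (inf_comm I ι.range).trans_le
      ((Subgroup.map_comap_eq ι I).symm.trans_le (Subgroup.map_mono (hker I hI)))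
  have : Group.IsNilpotent (G ⧸ N.normalCore) := by
    obtain ⟨m, hm⟩ := hH.exists_card_eq
    have hpow (h : H) : h ^ 2 ^ m = 1 := hm ▸ pow_card_eq_one'
    have hquot : IsPGroup 2 (G ⧸ ι.range) := .of_card (n := 1) hA
    refine (isPGroup_quotient_normalCore (m := m) hquot ?_).isNilpotent
    rintro _ ⟨a, rfl⟩
    exact ⟨a ^ 2 ^ m, by simp [MonoidHom.mem_ker, hpow], map_pow ι a _⟩
  obtain ⟨t, htA, htC, ht⟩ := exists_representatives_normalClosure_sup_eq_top hA htop
    (fun I hI ↦ inf_le_normalCore_of_forall_conj_smul_mem hconj hN hI) hJ hcover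
  have hNA : N ≤ ι.range := Subgroup.map_le_range ι _
  have hle := le_closure_sup_of_index_eq_two hA (N.normalCore_le.trans hNA) htA htC ht
  have hx (i : Fin n) : t 0 * t i.succ ∈ ι.range :=
    (Subgroup.mul_mem_iff_of_index_two hA).mpr (iff_of_false (htA 0) (htA _))
  choose x hx using hx
  refine ker_eq_ker_of_closure_sup_eq_top hgen hφ hψ (x := x) (top_le_iff.mp ?_)
  rw [← Subgroup.map_le_map_iff_of_injective hι, ← MonoidHom.range_eq_map, Subgroup.map_sup,
    MonoidHom.map_closure, ← Set.range_comp, show ι ∘ x = _ from funext hx]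
  exact hle.trans (sup_le_sup_left N.normalCore_le _)

theorem exists_quaternionGroup_hom {n : ℕ} {G : Type*} [Group G] {x y : G}
    (hx : x ^ (2 * n) = 1) (hy : y ^ 2 = x ^ n) (hxy : y * x * y⁻¹ = x⁻¹) :
    ∃ θ : QuaternionGroup n →* G, θ (.a 1) = x ∧ θ (.xa 0) = y := by
  let e : ZMod (2 * n) →+ Additive G := ZMod.lift (2 * n)
    ⟨zmultiplesHom _ (.ofMul x), by
      rw [zmultiplesHom_apply, natCast_zsmul, ← ofMul_pow, hx, ofMul_one]⟩
  let f (i : ZMod (2 * n)) : G := (e i).toMul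
  have hf (i : ℤ) : f i = x ^ i := by simp [f, e]
  have hadd (i j) : f (i + j) = f i * f j := by simp [f]
  have hneg (i) : f (-i) = (f i)⁻¹ := by simp [f]
  have hcomm (i) : f i * y = y * f (-i) := by
    obtain ⟨i, rfl⟩ := ZMod.intCast_surjective i
    have hconj : y * f (-i) * y⁻¹ = f i := by
      rw [hneg, hf, ← inv_zpow, ← conj_zpow, ← conj_inv, hxy, inv_inv]
    exact (mul_inv_eq_iff_eq_mul.mp hconj).symm
  have hsq : f n = y * y := by rw [← sq, hy]; exact_mod_cast hf n
  let F : QuaternionGroup n → G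
    | .a i => f i
    | .xa i => y * f i
  refine ⟨MonoidHom.mk' F ?_, ?_, ?_⟩
  · rintro (i | i) (j | j)
    · exact hadd i j
    · change y * f (j - i) = f i * (y * f j)
      rw [← mul_assoc, hcomm, mul_assoc, ← hadd, neg_add_eq_sub]
    · change y * f (i + j) = y * f i * f j
      rw [hadd, mul_assoc]
    · change f (n + j - i) = y * f i * (y * f j)
      rw [mul_assoc, ← mul_assoc (f i), hcomm, mul_assoc y, ← mul_assoc, ← hsq, ← hadd, ← hadd]
      ring_nf
  · change f 1 = x
    simpa using hf 1
  · change y * f 0 = y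
    simpa using hf 0

theorem quaternionGroup_two_relations_of_not_commute {x y : QuaternionGroup 2}
    (h : ¬ Commute x y) : x ^ 4 = 1 ∧ y ^ 2 = x ^ 2 ∧ y * x * y⁻¹ = x⁻¹ := by
  revert x y
  unfold Commute SemiconjBy
  decide

theorem commute_of_closure_pair_eq_top {H : Type*} [Group H] {x y : H}
    (h : closure {x, y} = ⊤) (hxy : Commute x y) (a b : H) : Commute a b := by
  have : IsMulCommutative (closure {x, y}) := Subgroup.isMulCommutative_closure <| by
    rintro _ (rfl | rfl) _ (rfl | rfl)
    exacts [rfl, hxy, hxy.symm, rfl]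
  exact congrArg Subtype.val
    (mul_comm' (⟨a, h ▸ Subgroup.mem_top a⟩ : closure {x, y}) ⟨b, h ▸ Subgroup.mem_top b⟩)

theorem exists_mulAut_quaternionGroup_two {x y : QuaternionGroup 2} (h : closure {x, y} = ⊤) :
    ∃ θ : MulAut (QuaternionGroup 2), θ (.a 1) = x ∧ θ (.xa 0) = y := by
  have hxy : ¬ Commute x y := fun hxy ↦
    absurd (commute_of_closure_pair_eq_top h hxy (.a 1) (.xa 0)).eq (by decide)
  obtain ⟨hx, hy, hconj⟩ := quaternionGroup_two_relations_of_not_commute hxy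
  obtain ⟨θ, rfl, rfl⟩ := exists_quaternionGroup_hom hx hy hconj
  have hsurj : Function.Surjective θ := by
    rw [← MonoidHom.range_eq_top, ← top_le_iff, ← h, Subgroup.closure_le]
    rintro _ (rfl | rfl)
    exacts [⟨_, rfl⟩, ⟨_, rfl⟩]
  exact ⟨.ofBijective θ ⟨Finite.injective_iff_surjective.mpr hsurj, hsurj⟩, rfl, rfl⟩

theorem mulAutTransitiveOnGenerators_quaternionGroup_two :
    MulAutTransitiveOnGenerators 2 (QuaternionGroup 2) := by
  intro x y hx hy
  have hrange (z : Fin 2 → QuaternionGroup 2) : Set.range z = {z 0, z 1} := by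
    ext
    simp [Fin.exists_fin_two, eq_comm]
  obtain ⟨θ, hθ₀, hθ₁⟩ := exists_mulAut_quaternionGroup_two (hrange x ▸ hx)
  obtain ⟨η, hη₀, hη₁⟩ := exists_mulAut_quaternionGroup_two (hrange y ▸ hy)
  refine ⟨θ.symm.trans η, Fin.forall_fin_two.mpr ⟨?_, ?_⟩⟩
  · rw [MulEquiv.trans_apply, ← hθ₀, θ.symm_apply_apply, hη₀]
  · rw [MulEquiv.trans_apply, ← hθ₁, θ.symm_apply_apply, hη₁]

theorem isPGroup_two_quaternionGroup_two : IsPGroup 2 (QuaternionGroup 2) :=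
  .of_card (n := 3) (by rw [Nat.card_eq_fintype_card, QuaternionGroup.card]; rfl)

/-- The inertia subgroups in `G` of the maximal ideals of `R`. For `G = Gal(F/ℚ)` and `R = 𝓞 F`
these are the inertia groups of the finite primes of `F`. -/
def inertiaSubgroups (G R : Type*) [Group G] [CommRing R] [MulSemiringAction G R] :
    Set (Subgroup G) :=
  {I | ∃ P : Ideal R, P.IsMaximal ∧ P.inertia G = I}

theorem inertia_smul_eq {G R : Type*} [Group G] [CommRing R] [MulSemiringAction G R]
    (g : G) (P : Ideal R) : (g • P).inertia G = MulAut.conj g • P.inertia G := by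
  ext τ
  rw [Subgroup.mem_pointwise_smul_iff_inv_smul_mem, ← map_inv, MulAut.smul_def, MulAut.conj_apply]
  refine (MulAction.surjective g).forall.trans (forall_congr' fun x ↦ ?_)
  have hconj : (g⁻¹ * τ * g⁻¹⁻¹) • x - x = g⁻¹ • (τ • g • x - g • x) := by
    rw [smul_sub, inv_smul_smul, inv_inv, mul_smul, mul_smul]
  rw [hconj]
  exact Ideal.mem_pointwise_smul_iff_inv_smul_mem

theorem conj_smul_mem_inertiaSubgroups {G R : Type*} [Group G] [CommRing R]
    [MulSemiringAction G R] {I : Subgroup G} (hI : I ∈ inertiaSubgroups G R) (g : G) :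
    MulAut.conj g • I ∈ inertiaSubgroups G R := by
  obtain ⟨P, hP, rfl⟩ := hI
  refine ⟨g • P, ?_, inertia_smul_eq g P⟩
  rw [Ideal.pointwise_smul_eq_comap]
  exact Ideal.comap_isMaximal_of_equiv _

theorem inertia_eq_bot_of_isUnramifiedAt {R S : Type*} (G : Type*) [CommRing R] [CommRing S]
    [Algebra R S] [Group G] [MulSemiringAction G S] [IsGaloisGroup G R S] [Finite G] [IsDomain R]
    [IsDomain S] [Module.Finite R S] [Module.Flat R S] (P : Ideal S) [P.IsPrime]
    [PerfectField (P.under R).ResidueField] [Algebra.IsUnramifiedAt R P] : P.inertia G = ⊥ := by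
  rw [← Subgroup.card_eq_one, Ideal.card_inertia_eq_ramificationIdxIn (P.under R) P,
    Ideal.ramificationIdxIn_eq_ramificationIdx (P.under R) P G, Ideal.ramificationIdx_eq_one]

theorem restrictNormalHom_mem_inertia_under {K M F : Type*} [Field K] [Field M] [Field F]
    [Algebra K M] [Algebra K F] [Algebra M F] [IsScalarTower K M F] [Normal K M]
    {P : Ideal (𝓞 F)} {σ : Gal(F/K)} (hσ : σ ∈ P.inertia Gal(F/K)) :
    AlgEquiv.restrictNormalHom M σ ∈ (P.under (𝓞 M)).inertia Gal(M/K) := by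
  intro x
  have hcomm : algebraMap (𝓞 M) (𝓞 F) (AlgEquiv.restrictNormalHom M σ • x) =
      σ • algebraMap (𝓞 M) (𝓞 F) x :=
    NumberField.RingOfIntegers.ext (AlgEquiv.restrictNormal_commutes σ M (x : M))
  change algebraMap (𝓞 M) (𝓞 F) (_ - x) ∈ P
  rw [map_sub, hcomm]
  exact hσ _

theorem inertia_le_ker_restrictNormalHom (R : Type*) {K M F : Type*} [CommRing R] [IsDomain R]
    [Field K] [Field M] [NumberField M] [Field F] [Algebra K M] [Algebra K F] [Algebra M F]
    [IsScalarTower K M F] [Normal K M] [FiniteDimensional K M] [Algebra R (𝓞 M)]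
    [IsGaloisGroup Gal(M/K) R (𝓞 M)] [Module.Finite R (𝓞 M)] [Module.Flat R (𝓞 M)]
    {P : Ideal (𝓞 F)} [P.IsPrime] [PerfectField ((P.under (𝓞 M)).under R).ResidueField]
    [Algebra.IsUnramifiedAt R (P.under (𝓞 M))] :
    P.inertia Gal(F/K) ≤ (AlgEquiv.restrictNormalHom M).ker := by
  intro σ hσ
  have := restrictNormalHom_mem_inertia_under (M := M) hσ
  rwa [inertia_eq_bot_of_isUnramifiedAt (R := R), Subgroup.mem_bot] at this

theorem sSup_inertiaSubgroups_eq_top (F : Type*) [Field F] [NumberField F] [IsGalois ℚ F] :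
    sSup (inertiaSubgroups Gal(F/ℚ) (𝓞 F)) = ⊤ := by
  set H := sSup (inertiaSubgroups Gal(F/ℚ) (𝓞 F))
  let E := IntermediateField.fixedField H
  suffices h : Module.finrank ℚ E = 1 by
    rw [← IntermediateField.fixingSubgroup_fixedField H,
      show IntermediateField.fixedField H = ⊥ from IntermediateField.finrank_eq_one_iff.mp h,
      IntermediateField.fixingSubgroup_bot]
  by_contra hE
  obtain ⟨𝔭, h𝔭, hram⟩ := NumberField.exists_not_isUnramifiedAt_int (𝒪 := 𝓞 E) hE
  apply hram
  obtain ⟨P, hP, hlies⟩ := Ideal.exists_maximal_ideal_liesOver_of_isIntegral (S := 𝓞 F) 𝔭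
  -- As `H` contains the inertia group of `P`, the index `e(P/𝔭)` equals `e(P/ℤ)`: so `e(𝔭/ℤ) = 1`.
  have hle : P.inertia Gal(F/ℚ) ≤ H := le_sSup ⟨P, hP, rfl⟩
  have hcard : Nat.card (P.inertia Gal(F/ℚ)) = Nat.card (P.inertia H) :=
    (Nat.card_congr (Subgroup.subgroupOfEquivOfLe hle).toEquiv).symm
  have : IsGaloisGroup H E F := IsGaloisGroup.subgroup Gal(F/ℚ) ℚ F H
  have : IsGaloisGroup H (𝓞 E) (𝓞 F) := IsGaloisGroup.of_isFractionRing H (𝓞 E) (𝓞 F) E F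
  rw [Ideal.card_inertia_eq_ramificationIdxIn (P.under ℤ) P,
    Ideal.ramificationIdxIn_eq_ramificationIdx (P.under ℤ) P Gal(F/ℚ),
    Ideal.card_inertia_eq_ramificationIdxIn 𝔭 P,
    Ideal.ramificationIdxIn_eq_ramificationIdx 𝔭 P H] at hcard
  have htower := Ideal.ramificationIdx_tower (R := ℤ) 𝔭 P
  rw [hcard] at htower
  exact Ideal.ramificationIdx_eq_one_iff.mp
    ((Nat.mul_eq_right (P.ramificationIdx_pos (𝓞 E)).ne').mp htower.symm)

theorem inertia_le_ker_restrictNormalHom_of_not_dvd_discr {k F : Type*} [Field k] [Field F]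
    [NumberField k] [NumberField F] [Algebra k F] [IsGalois ℚ k] {P : Ideal (𝓞 F)}
    [P.IsMaximal] {p : ℕ} (hp : p.Prime) (hpP : (p : 𝓞 F) ∈ P)
    (hd : ¬ (p : ℤ) ∣ NumberField.discr k) :
    P.inertia Gal(F/ℚ) ≤ (AlgEquiv.restrictNormalHom k).ker := by
  have hpk : (p : 𝓞 k) ∈ P.under (𝓞 k) := by simpa [Ideal.mem_comap] using hpP
  have : Algebra.IsUnramifiedAt ℤ (P.under (𝓞 k)) :=
    (NumberField.not_dvd_discr_iff_forall_mem k (𝓞 k) (Nat.prime_iff_prime_int.mp hp)).mp hd _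
      inferInstance (by exact_mod_cast hpk)
  exact inertia_le_ker_restrictNormalHom ℤ

theorem exists_inertiaSubgroups_forall_le_or_conj {ι k F : Type*} [Field k] [NumberField k]
    [IsGalois ℚ k] [Field F] [NumberField F] [IsGalois ℚ F] [Algebra k F] {p : ι → ℕ}
    (hp : ∀ j, (p j).Prime) (hd : ∀ q : ℕ, q.Prime → (q : ℤ) ∣ NumberField.discr k → ∃ j, p j = q) :
    ∃ J : ι → Subgroup Gal(F/ℚ), (∀ j, J j ∈ inertiaSubgroups Gal(F/ℚ) (𝓞 F)) ∧
      ∀ I ∈ inertiaSubgroups Gal(F/ℚ) (𝓞 F),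
        I ≤ (AlgEquiv.restrictNormalHom k).ker ∨ ∃ j, ∃ g : Gal(F/ℚ), MulAut.conj g • J j = I := by
  have hlies (j) : ∃ P : Ideal (𝓞 F), P.IsMaximal ∧ P.LiesOver (Ideal.span {(p j : ℤ)}) := by
    have : Fact (p j).Prime := ⟨hp j⟩
    exact Ideal.exists_maximal_ideal_liesOver_of_isIntegral (S := 𝓞 F) _
  choose P hPmax hPlies using hlies
  refine ⟨fun j ↦ (P j).inertia Gal(F/ℚ), fun j ↦ ⟨P j, hPmax j, rfl⟩, ?_⟩
  rintro _ ⟨Q, hQ, rfl⟩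
  have : NeZero Q := ⟨Ideal.IsMaximal.ne_bot_of_isIntegral_int Q⟩
  by_cases hdvd : ((Q.under ℤ).absNorm : ℤ) ∣ NumberField.discr k
  · obtain ⟨j, hj⟩ := hd _ (Nat.absNorm_under_prime Q) hdvd
    have : Q.LiesOver (Ideal.span {(p j : ℤ)}) := hj ▸ Int.liesOver_span_absNorm Q
    obtain ⟨g, hg⟩ :=
      Ideal.exists_smul_eq_of_isGaloisGroup (Ideal.span {(p j : ℤ)}) (P j) Q Gal(F/ℚ)
    exact .inr ⟨j, g, by rw [← inertia_smul_eq, hg]⟩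
  · exact .inl (inertia_le_ker_restrictNormalHom_of_not_dvd_discr (Nat.absNorm_under_prime Q)
      (Int.absNorm_under_mem Q) hdvd)

theorem range_restrictScalarsHom_eq_ker_restrictNormalHom {R K L : Type*} [Field R] [Field K]
    [Field L] [Algebra R K] [Algebra R L] [Algebra K L] [IsScalarTower R K L] [Normal R K] :
    (AlgEquiv.restrictScalarsHom R : Gal(L/K) →* Gal(L/R)).range =
      (AlgEquiv.restrictNormalHom K).ker := by
  ext σ
  have hcomm := AlgEquiv.restrictNormal_commutes σ K
  constructor
  · rintro ⟨τ, rfl⟩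
    exact AlgEquiv.ext fun x ↦ (algebraMap K L).injective ((hcomm x).trans (τ.commutes x))
  · intro hσ
    refine ⟨{ σ with commutes' := fun x ↦ ?_ }, rfl⟩
    rw [show σ.restrictNormal K = 1 from hσ] at hcomm
    exact (hcomm x).symm

theorem index_range_restrictScalarsHom {R K L : Type*} [Field R] [Field K]
    [Field L] [Algebra R K] [Algebra R L] [Algebra K L] [IsScalarTower R K L] [IsGalois R K]
    [FiniteDimensional R K] [Normal R L] :
    (AlgEquiv.restrictScalarsHom R : Gal(L/K) →* Gal(L/R)).range.index = Module.finrank R K := by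
  rw [range_restrictScalarsHom_eq_ker_restrictNormalHom, Subgroup.index_ker,
    MonoidHom.range_eq_top.mpr (AlgEquiv.restrictNormalHom_surjective L), Subgroup.card_top,
    IsGalois.card_aut_eq_finrank]

theorem ker_restrictNormalHom_eq_fixingSubgroup_fieldRange {K M F : Type*} [Field K] [Field M]
    [Field F] [Algebra K M] [Algebra K F] [Algebra M F] [IsScalarTower K M F] [Normal K M] :
    (AlgEquiv.restrictNormalHom M : Gal(F/K) →* Gal(M/K)).ker =
      (IsScalarTower.toAlgHom K M F).fieldRange.fixingSubgroup := by
  ext σ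
  have hcomm := AlgEquiv.restrictNormal_commutes σ M
  rw [IntermediateField.mem_fixingSubgroup_iff]
  constructor
  · rintro hσ _ ⟨x, rfl⟩
    rw [show σ.restrictNormal M = 1 from hσ] at hcomm
    exact (hcomm x).symm
  · exact fun hσ ↦ AlgEquiv.ext fun x ↦
      (algebraMap M F).injective ((hcomm x).trans (hσ _ ⟨x, rfl⟩))

theorem exists_fin_primes_of_card_primeFactors_le {d n : ℕ} (hd : d ≠ 0)
    (hn : d.primeFactors.card ≤ n) :
    ∃ p : Fin n → ℕ, (∀ j, (p j).Prime) ∧ ∀ q : ℕ, q.Prime → q ∣ d → ∃ j, p j = q := by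
  obtain ⟨e⟩ : Nonempty (d.primeFactors ↪ Fin n) :=
    Function.Embedding.nonempty_of_card_le (by simpa using hn)
  refine ⟨Function.extend e Subtype.val fun _ ↦ 2, fun j ↦ ?_, fun q hq hqd ↦
    ⟨e ⟨q, Nat.mem_primeFactors.mpr ⟨hq, hqd, hd⟩⟩, e.injective.extend_apply _ _ _⟩⟩
  by_cases hj : ∃ q, e q = j
  · obtain ⟨q, rfl⟩ := hj
    rw [e.injective.extend_apply]
    exact Nat.prime_of_mem_primeFactors q.2
  · rw [Function.extend_apply' _ _ _ hj]
    exact Nat.prime_two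

section

variable {k F M N H : Type*} [Field k] [NumberField k] [Field F] [NumberField F] [IsGalois ℚ F]
  [Algebra k F] [Field M] [Field N] [Algebra k M] [Algebra k N] [FiniteDimensional k M]
  [FiniteDimensional k N] [IsGalois k M] [IsGalois k N] [Group H] {n : ℕ}

theorem ker_restrictNormalHom_eq_of_isUnramifiedOutsideInfinity [Algebra M F] [Algebra N F]
    [IsScalarTower k M F] [IsScalarTower k N F] (hk : Module.finrank ℚ k = 2)
    (hd : (NumberField.discr k).natAbs.primeFactors.card ≤ n + 1) (hH : IsPGroup 2 H)
    (hgen : MulAutTransitiveOnGenerators n H) (eM : Gal(M/k) ≃* H) (eN : Gal(N/k) ≃* H)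
    (hM : IsUnramifiedOutsideInfinity k M) (hN : IsUnramifiedOutsideInfinity k N) :
    (AlgEquiv.restrictNormalHom M : Gal(F/k) →* Gal(M/k)).ker =
      (AlgEquiv.restrictNormalHom N : Gal(F/k) →* Gal(N/k)).ker := by
  have : Algebra.IsQuadraticExtension ℚ k := { finrank_eq_two' := hk }
  have : IsGalois k F := .tower_top_of_isGalois ℚ k F
  obtain ⟨p, hp, hpd⟩ := exists_fin_primes_of_card_primeFactors_le
    (Int.natAbs_ne_zero.mpr (NumberField.discr_ne_zero k)) hd
  obtain ⟨J, hJ, hcover⟩ := exists_inertiaSubgroups_forall_le_or_conj (F := F) hp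
    fun q hq hqd ↦ hpd q hq (Int.natCast_dvd.mp hqd)
  rw [← range_restrictScalarsHom_eq_ker_restrictNormalHom] at hcover
  have : NumberField M := .of_module_finite k M
  have : NumberField N := .of_module_finite k N
  rw [← MonoidHom.ker_mulEquiv_comp _ eM, ← MonoidHom.ker_mulEquiv_comp _ eN]
  refine ker_eq_ker_of_index_eq_two hH hgen (AlgEquiv.restrictScalarsHom_injective ℚ)
    (index_range_restrictScalarsHom.trans hk)
    (eM.surjective.comp (AlgEquiv.restrictNormalHom_surjective F))
    (eN.surjective.comp (AlgEquiv.restrictNormalHom_surjective F))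
    (fun I hI ↦ conj_smul_mem_inertiaSubgroups hI) (sSup_inertiaSubgroups_eq_top F) ?_ hJ hcover
  rintro _ ⟨P, hP, rfl⟩
  have := hM (P.under (𝓞 M)) inferInstance
  have := hN (P.under (𝓞 N)) inferInstance
  rw [MonoidHom.ker_mulEquiv_comp, MonoidHom.ker_mulEquiv_comp]
  exact le_inf (inertia_le_ker_restrictNormalHom (𝓞 k)) (inertia_le_ker_restrictNormalHom (𝓞 k))

theorem fieldRange_eq_of_isUnramifiedOutsideInfinity (hk : Module.finrank ℚ k = 2)
    (hd : (NumberField.discr k).natAbs.primeFactors.card ≤ n + 1) (hH : IsPGroup 2 H)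
    (hgen : MulAutTransitiveOnGenerators n H) (eM : Gal(M/k) ≃* H) (eN : Gal(N/k) ≃* H)
    (hM : IsUnramifiedOutsideInfinity k M) (hN : IsUnramifiedOutsideInfinity k N)
    (f : M →ₐ[k] F) (g : N →ₐ[k] F) : f.fieldRange = g.fieldRange := by
  let : Algebra M F := f.toAlgebra
  let : Algebra N F := g.toAlgebra
  have : IsScalarTower k M F := .of_algHom f
  have : IsScalarTower k N F := .of_algHom g
  have : IsGalois k F := .tower_top_of_isGalois ℚ k F
  have : FiniteDimensional k F := .of_restrictScalars_finite ℚ k F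
  have hker :=
    ker_restrictNormalHom_eq_of_isUnramifiedOutsideInfinity (F := F) hk hd hH hgen eM eN hM hN
  rw [ker_restrictNormalHom_eq_fixingSubgroup_fieldRange,
    ker_restrictNormalHom_eq_fixingSubgroup_fieldRange] at hker
  exact IsGalois.intermediateFieldEquivSubgroup.injective hker

end

theorem exists_numberField_isGalois_algHom (L : Type*) [Field L] [NumberField L] :
    ∃ F : IntermediateField ℚ (AlgebraicClosure L),
      NumberField F ∧ IsGalois ℚ F ∧ Nonempty (L →ₐ[ℚ] F) := by
  have : Algebra.IsAlgebraic ℚ (AlgebraicClosure L) := .trans ℚ L _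
  have : IsAlgClosure ℚ (AlgebraicClosure L) := ⟨inferInstance, inferInstance⟩
  have : Normal ℚ (AlgebraicClosure L) := IsAlgClosure.normal ℚ _
  let f : L →ₐ[ℚ] AlgebraicClosure L := IsScalarTower.toAlgHom ℚ L _
  exact ⟨.normalClosure ℚ L _, ⟨⟩, { to_normal := normalClosure.normal ℚ L _ },
    ⟨(IntermediateField.inclusion f.fieldRange_le_normalClosure).comp f.rangeRestrict⟩⟩

theorem card_primeFactors_natAbs_of_isPrimeDiscriminant {d : ℤ} (hd : IsPrimeDiscriminant d) :
    d.natAbs.primeFactors.card = 1 := by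
  rw [← isPrimePow_iff_card_primeFactors_eq_one]
  obtain rfl | rfl | rfl | ⟨hp, -⟩ := hd
  · exact Nat.prime_two.isPrimePow.pow two_ne_zero
  · exact Nat.prime_two.isPrimePow.pow three_ne_zero
  · exact Nat.prime_two.isPrimePow.pow three_ne_zero
  · exact hp.isPrimePow

theorem card_primeFactors_mul_le (a b : ℕ) :
    (a * b).primeFactors.card ≤ a.primeFactors.card + b.primeFactors.card := by
  rcases eq_or_ne a 0 with rfl | ha
  · simp
  rcases eq_or_ne b 0 with rfl | hb
  · simp
  · exact Nat.primeFactors_mul ha hb ▸ Finset.card_union_le _ _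

theorem mainTheorem7_general {k : Type*} [Field k] [NumberField k]
    (hk : Module.finrank ℚ k = 2) {n : ℕ}
    (hd : (NumberField.discr k).natAbs.primeFactors.card ≤ n + 1)
    {H : Type*} [Group H] (hH : IsPGroup 2 H) (hgen : MulAutTransitiveOnGenerators n H)
    {Ω : Type*} [Field Ω] [Algebra k Ω] (M N : IntermediateField k Ω)
    [FiniteDimensional k M] [FiniteDimensional k N] [IsGalois k M] [IsGalois k N]
    (eM : Gal(M/k) ≃* H) (eN : Gal(N/k) ≃* H)
    (hM : IsUnramifiedOutsideInfinity k M) (hN : IsUnramifiedOutsideInfinity k N) : M = N := by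
  let L := M ⊔ N
  have : NumberField L := .of_module_finite k L
  obtain ⟨F, _, _, ⟨f⟩⟩ := exists_numberField_isGalois_algHom L
  let : Algebra k F := ((f : L →+* F).comp (algebraMap k L)).toAlgebra
  let fk : L →ₐ[k] F := { f with commutes' := fun _ ↦ rfl }
  have hrange := fieldRange_eq_of_isUnramifiedOutsideInfinity hk hd hH hgen eM eN hM hN
    (fk.comp (IntermediateField.inclusion le_sup_left))
    (fk.comp (IntermediateField.inclusion le_sup_right))
  rw [← AlgHom.map_fieldRange, ← AlgHom.map_fieldRange] at hrange
  have hrestrict : IntermediateField.restrict (le_sup_left : M ≤ M ⊔ N) =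
      IntermediateField.restrict (le_sup_right : N ≤ M ⊔ N) :=
    IntermediateField.map_injective fk hrange
  rw [← IntermediateField.lift_restrict (le_sup_left : M ≤ M ⊔ N), hrestrict,
    IntermediateField.lift_restrict]

theorem mainTheorem7 {k : Type*} [Field k] [NumberField k]
    (hk : Module.finrank ℚ k = 2) (d₁ d₂ d₃ : ℤ)
    (h₁ : IsPrimeDiscriminant d₁) (h₂ : IsPrimeDiscriminant d₂) (h₃ : IsPrimeDiscriminant d₃)
    (hd : NumberField.discr k = d₁ * d₂ * d₃)
    {Ω : Type*} [Field Ω] [Algebra k Ω] (M N : IntermediateField k Ω)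
    (hM : IsUnramifiedH8Extension k M) (hN : IsUnramifiedH8Extension k N) :
    M = N := by
  have : FiniteDimensional k M := hM.finiteDimensional
  have : FiniteDimensional k N := hN.finiteDimensional
  have : IsGalois k M := hM.isGalois
  have : IsGalois k N := hN.isGalois
  obtain ⟨eM⟩ := hM.galois_group
  obtain ⟨eN⟩ := hN.galois_group
  have hcard : (NumberField.discr k).natAbs.primeFactors.card ≤ 2 + 1 := by
    rw [hd, Int.natAbs_mul, Int.natAbs_mul]
    refine (card_primeFactors_mul_le _ _).trans (add_le_add ?_ ?_)
    · refine (card_primeFactors_mul_le _ _).trans_eq ?_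
      rw [card_primeFactors_natAbs_of_isPrimeDiscriminant h₁,
        card_primeFactors_natAbs_of_isPrimeDiscriminant h₂]
    · exact (card_primeFactors_natAbs_of_isPrimeDiscriminant h₃).le
  exact mainTheorem7_general hk hcard isPGroup_two_quaternionGroup_two
    mulAutTransitiveOnGenerators_quaternionGroup_two M N eM eN hM.unramified hN.unramified
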